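/- Let $B$ be the ring of integers of a number field, let $a,b,c\in B$, and let $A=B[X,Y]/(aX^2+bXY+cY^2-1)$. Let $\Gamma$ be the set of prime ideals $P$ of $B$ with $P\supseteq (2,b)B$ and $P\not\supseteq (a,c)B$. For each $P\in\Gamma$ choose $d,e\in B$ (depending on $P$) with $d^2\equiv a$ and $e^2\equiv c \pmod P$; such $d,e$ exist and are unique modulo $P$, because $B/P$ is a finite field of characteristic $2$. Then $A$ is a regular ring if and only if for every $P\in\Gamma$: (i) if $a\notin P$, then $b-2de\in P^2$, $cd^2-ae^2\in P^2$ and $a-d^2\notin P^2$; (ii) if $a\in P$, then $a\in P^2$, $b\in P^2$ and $c-e^2\notin P^2$. -/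

import Mathlib

open scoped NumberField

/-- The polynomial `g = a X² + b X Y + c Y² - 1` in `B[X, Y]` (`X = X 0`, `Y = X 1`). -/
noncomputable def conicPoly {B : Type*} [CommRing B] (a b c : B) : MvPolynomial (Fin 2) B :=
  MvPolynomial.C a * MvPolynomial.X 0 ^ 2
    + MvPolynomial.C b * MvPolynomial.X 0 * MvPolynomial.X 1
    + MvPolynomial.C c * MvPolynomial.X 1 ^ 2 - 1

/-- The ring `A = B[X, Y] / (a X² + b X Y + c Y² - 1)`. -/
abbrev ConicRing {B : Type*} [CommRing B] (a b c : B) : Type _ :=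
  MvPolynomial (Fin 2) B ⧸ Ideal.span {conicPoly a b c}

/-- The set `Γ` of the prime ideals `P` of `B` that contain `(2, b)B` and do not
contain `(a, c)B`. -/
def conicGamma {B : Type*} [CommRing B] (a b c : B) : Set (Ideal B) :=
  {P | P.IsPrime ∧ Ideal.span {2, b} ≤ P ∧ ¬ Ideal.span {a, c} ≤ P}

/-- For `P ∈ Γ`, every element of `B / P` is a square, so that the square roots `d`, `e`
modulo `P` of `a` and `c` exist; they are unique modulo `P`. -/
theorem conicGamma_existsUnique_sqrt {K : Type*} [Field K] [NumberField K] {a b c : 𝓞 K}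
    {P : Ideal (𝓞 K)} (hP : P ∈ conicGamma a b c) (z : 𝓞 K) :
    ∃! r : 𝓞 K ⧸ P, r ^ 2 = Ideal.Quotient.mk P z := by
  obtain ⟨hp, h2, -⟩ := hP
  have h2P : (2 : 𝓞 K) ∈ P := h2 (Ideal.subset_span (by simp))
  have hne : P ≠ ⊥ := by
    rintro rfl
    exact two_ne_zero ((Ideal.mem_bot).1 h2P)
  have : Finite (𝓞 K ⧸ P) := Ideal.finiteQuotientOfFreeOfNeBot P hne
  have h20 : (2 : 𝓞 K ⧸ P) = 0 := by
    have := Ideal.Quotient.eq_zero_iff_mem.2 h2P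
    exact (map_ofNat (Ideal.Quotient.mk P) 2).symm.trans this
  have inj : Function.Injective (fun r : 𝓞 K ⧸ P => r ^ 2) := by
    intro r s hrs
    have hrs' : r ^ 2 = s ^ 2 := hrs
    have h : (r - s) ^ 2 = 0 := by linear_combination hrs' + (s ^ 2 - r * s) * h20
    exact sub_eq_zero.1 (pow_eq_zero_iff two_ne_zero |>.1 h)
  obtain ⟨r, hr⟩ := Finite.surjective_of_injective inj (Ideal.Quotient.mk P z)
  exact ⟨r, hr, fun s hs => inj (hs.trans hr.symm)⟩

/-! Since `B[X, Y]` is a regular domain, `A` fails to be regular exactly when `g` vanishes to order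
two at some prime `Q ∋ g` (`isRegularRing_quotient_span_singleton_iff`). Both partial derivatives of
`g` then lie in `Q`, and Euler's relation `X g_X + Y g_Y - 2g = 2` forces `P = Q ∩ B` into `Γ`
(`comap_C_mem_conicGamma`). Above `P ∈ Γ` write `g = h² + r + 2h` with `h = dX + eY - 1`; the
quadratic form `r` has coefficients in `P`. Modulo `P` the conic is the double line `h = 0`, so `h ∈
Q`, both `h²` and `2h` lie in `Q²`, and only `r` matters. Locally `r = πρ` with `π` a uniformizer,
which has order one at `Q` (`mul_C_notMem_sq`). Regularity above `P` thus means that `ρ` has no zero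
on the line, i.e. restricts to a nonzero constant in a polynomial ring in one variable over `B/P`.
Parametrizing the line by `Y` if `d ∉ P` and by `X` if `d ∈ P` turns this into (i) and (ii). -/

/-! ### Regular local rings modulo one element -/

open IsLocalRing in
/-- If `x ∈ 𝔪²`, lifts of generators of the maximal ideal of `S ⧸ (x)` generate `𝔪`. -/
theorem spanFinrank_maximalIdeal_le_of_mem_sq {S : Type*} [CommRing S] [IsLocalRing S]
    [IsNoetherianRing S] {x : S} [IsLocalRing (S ⧸ Ideal.span {x})]
    (hx2 : x ∈ maximalIdeal S ^ 2) :
    (maximalIdeal S).spanFinrank ≤ (maximalIdeal (S ⧸ Ideal.span {x})).spanFinrank := by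
  set f := Ideal.Quotient.mk (Ideal.span {x}) with hf
  have hsurj : Function.Surjective f := Ideal.Quotient.mk_surjective
  have hfg := (maximalIdeal (S ⧸ Ideal.span {x})).fg_of_isNoetherianRing
  set T := (maximalIdeal (S ⧸ Ideal.span {x})).generators with hT
  have hTfin : T.Finite := Submodule.FG.finite_generators hfg
  have hTspan : Ideal.span T = maximalIdeal (S ⧸ Ideal.span {x}) :=
    (maximalIdeal (S ⧸ Ideal.span {x})).span_generators
  set s := Function.surjInv hsurj '' T with hs
  have hfs : f '' s = T := by
    rw [hs, Set.image_image]
    simp [Function.surjInv_eq hsurj]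
  have hcomap : (maximalIdeal (S ⧸ Ideal.span {x})).comap f = maximalIdeal S :=
    eq_maximalIdeal (Ideal.comap_isMaximal_of_surjective f hsurj)
  have hspan : Ideal.span s = maximalIdeal S := by
    apply le_antisymm
    · rw [← hcomap, ← Ideal.map_le_iff_le_comap, Ideal.map_span, hfs, hTspan]
    -- Nakayama: the preimage of the maximal ideal is `span s ⊔ (x)`, and `(x) ≤ 𝔪²`.
    · refine Submodule.le_of_le_smul_of_le_jacobson_bot (IsNoetherian.noetherian _)
        (IsLocalRing.jacobson_eq_maximalIdeal _ bot_ne_top).ge ?_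
      rw [smul_eq_mul, ← pow_two]
      conv_lhs => rw [← hcomap, ← hTspan, ← hfs, ← Ideal.map_span,
        Ideal.comap_map_of_surjective f hsurj, ← RingHom.ker_eq_comap_bot, hf, Ideal.mk_ker]
      exact sup_le le_sup_left
        (((Ideal.span_singleton_le_iff_mem _).2 hx2).trans le_sup_right)
  calc (maximalIdeal S).spanFinrank = (Ideal.span s).spanFinrank := by rw [hspan]
    _ ≤ s.ncard := Submodule.spanFinrank_span_le_ncard_of_finite (hTfin.image _)
    _ ≤ T.ncard := Set.ncard_image_le hTfin
    _ = _ := Submodule.FG.generators_ncard hfg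

open IsLocalRing in
/-- If `x ∈ 𝔪 ∖ 𝔪²`, the maximal ideal of `S ⧸ (x)` needs fewer generators than `𝔪`. -/
theorem spanFinrank_maximalIdeal_quotient_add_one_le {S : Type*} [CommRing S] [IsLocalRing S]
    [IsNoetherianRing S] {x : S} [IsLocalRing (S ⧸ Ideal.span {x})] (hx : x ∈ maximalIdeal S)
    (hx2 : x ∉ maximalIdeal S ^ 2) :
    (maximalIdeal (S ⧸ Ideal.span {x})).spanFinrank + 1 ≤ (maximalIdeal S).spanFinrank := by
  set f := Ideal.Quotient.mk (Ideal.span {x}) with hf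
  have hmap : (maximalIdeal S).map f = maximalIdeal (S ⧸ Ideal.span {x}) :=
    map_maximalIdeal_of_surjective f Ideal.Quotient.mk_surjective
  set v : CotangentSpace S := (maximalIdeal S).toCotangent ⟨x, hx⟩ with hv
  have hv0 : v ≠ 0 := fun h => hx2 (((maximalIdeal S).toCotangent_eq_zero _).1 h)
  set L := Submodule.span (ResidueField S) {v} with hL
  have hdim : Module.finrank (ResidueField S) (CotangentSpace S ⧸ L) + 1 =
      (maximalIdeal S).spanFinrank := by
    rw [spanFinrank_maximalIdeal_eq_finrank_cotangentSpace,
      ← Submodule.finrank_quotient_add_finrank L, hL, finrank_span_singleton hv0]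
  -- Lifts of a basis of `(𝔪/𝔪²)/L`, together with `x`, generate `𝔪` by Nakayama; `x` dies in the
  -- quotient.
  set b := Module.finBasis (ResidueField S) (CotangentSpace S ⧸ L)
  have hlift : ∀ i, ∃ y : maximalIdeal S, L.mkQ ((maximalIdeal S).toCotangent y) = b i := by
    intro i
    obtain ⟨w, hw⟩ := L.mkQ_surjective (b i)
    obtain ⟨y, rfl⟩ := (maximalIdeal S).toCotangent_surjective w
    exact ⟨y, hw⟩
  choose y hy using hlift
  have htop : Submodule.span (ResidueField S)
      ((maximalIdeal S).toCotangent '' (insert ⟨x, hx⟩ (Set.range y))) = ⊤ := by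
    rw [Set.image_insert_eq, Submodule.span_insert, ← hv, ← hL]
    set N := Submodule.span (ResidueField S) ((maximalIdeal S).toCotangent '' Set.range y) with hN
    have hNmap : N.map L.mkQ = ⊤ := by
      rw [hN, Submodule.map_span, ← b.span_eq]
      congr 1
      rw [Set.image_image, ← Set.range_comp]
      exact congrArg Set.range (funext hy)
    have := Submodule.comap_map_eq L.mkQ N
    rw [hNmap, Submodule.comap_top, Submodule.ker_mkQ] at this
    rw [sup_comm, ← this]
  rw [CotangentSpace.span_image_eq_top_iff] at htop
  have hm : maximalIdeal S = Ideal.span (insert x (Set.range fun i => (y i : S))) := by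
    have := congrArg (Submodule.map (maximalIdeal S).subtype) htop
    rw [Submodule.map_span, Submodule.map_top, Submodule.range_subtype] at this
    refine this.symm.trans ?_
    rw [Set.image_insert_eq, ← Set.range_comp]
    rfl
  have hm' : maximalIdeal (S ⧸ Ideal.span {x}) = Ideal.span (Set.range fun i => f (y i : S)) := by
    rw [← hmap]
    conv_lhs => rw [hm]
    rw [Ideal.map_span, Set.image_insert_eq, ← Set.range_comp,
      Ideal.Quotient.eq_zero_iff_mem.2 (Ideal.mem_span_singleton_self x)]
    exact Submodule.span_insert_zero
  rw [← hdim, hm']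
  gcongr
  refine (Submodule.spanFinrank_span_le_ncard_of_finite (Set.finite_range _)).trans ?_
  rw [← Set.image_univ]
  refine (Set.ncard_image_le Set.finite_univ).trans ?_
  simp [Set.ncard_univ]

open IsLocalRing in
/-- Cutting a regular local domain by a nonzero element `x` of the maximal ideal gives a regular
local ring if and only if `x` is part of a regular system of parameters. -/
theorem isRegularLocalRing_quotient_span_singleton_iff {S : Type*} [CommRing S] [IsDomain S]
    [IsRegularLocalRing S] {x : S} (hx : x ∈ maximalIdeal S) (hx0 : x ≠ 0) :
    IsRegularLocalRing (S ⧸ Ideal.span {x}) ↔ x ∉ maximalIdeal S ^ 2 := by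
  have hne : Ideal.span {x} ≠ ⊤ := fun h => (mem_maximalIdeal x).1 hx
    (Ideal.span_singleton_eq_top.1 h)
  have : Nontrivial (S ⧸ Ideal.span {x}) := Ideal.Quotient.nontrivial_iff.2 hne
  have hloc : IsLocalRing (S ⧸ Ideal.span {x}) :=
    IsLocalRing.of_surjective' (Ideal.Quotient.mk _) Ideal.Quotient.mk_surjective
  have hdim : ringKrullDim (S ⧸ Ideal.span {x}) + 1 = (maximalIdeal S).spanFinrank := by
    rw [(isRegularLocalRing_iff S).1 inferInstance]
    exact ringKrullDim_quotient_span_singleton_succ_eq_ringKrullDim_of_mem_nonZeroDivisors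
      (mem_nonZeroDivisors_of_ne_zero hx0) hx
  constructor
  · intro hreg hx2
    have h1 := spanFinrank_maximalIdeal_le_of_mem_sq hx2
    rw [← (isRegularLocalRing_iff _).1 hreg] at hdim
    have : (maximalIdeal (S ⧸ Ideal.span {x})).spanFinrank + 1 = (maximalIdeal S).spanFinrank := by
      exact_mod_cast hdim
    omega
  · intro hx2
    have h1 := spanFinrank_maximalIdeal_quotient_add_one_le hx hx2
    apply IsRegularLocalRing.of_spanFinrank_maximalIdeal_le
    have h2 : ((maximalIdeal (S ⧸ Ideal.span {x})).spanFinrank : WithBot ℕ∞) + 1 ≤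
        ringKrullDim (S ⧸ Ideal.span {x}) + 1 := by
      rw [hdim]; exact_mod_cast h1
    exact ENat.WithBot.add_le_add_one_right_iff.1 h2

/-! ### Hypersurfaces in regular domains -/

/-- Localization at a prime commutes with taking quotients. -/
noncomputable def localizationQuotientEquiv {R : Type*} [CommRing R] (I Q : Ideal R) [Q.IsPrime]
    (q : Ideal (R ⧸ I)) [q.IsPrime] (hq : q.comap (Ideal.Quotient.mk I) = Q) :
    (Localization.AtPrime Q ⧸ I.map (algebraMap R (Localization.AtPrime Q))) ≃+*
      Localization.AtPrime q := by
  have h : Algebra.algebraMapSubmonoid (R ⧸ I) Q.primeCompl = q.primeCompl := by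
    ext z
    obtain ⟨z, rfl⟩ := Ideal.Quotient.mk_surjective z
    constructor
    · rintro ⟨w, hw, hwz⟩ hz
      refine hw ?_
      rw [← hq]
      change Ideal.Quotient.mk I w ∈ q
      rw [← Ideal.Quotient.algebraMap_eq, hwz]
      exact hz
    · intro hz
      refine ⟨z, ?_, rfl⟩
      rintro hzQ
      rw [← hq] at hzQ
      exact hz hzQ
  have : IsLocalization q.primeCompl
      (Localization.AtPrime Q ⧸ I.map (algebraMap R (Localization.AtPrime Q))) := by
    rw [← h]; infer_instance
  exact (IsLocalization.algEquiv q.primeCompl _ (Localization.AtPrime q)).toRingEquiv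

theorem mem_maximalIdeal_sq_localization_iff {R : Type*} [CommRing R] {Q : Ideal R} [Q.IsPrime]
    {x : R} : algebraMap R (Localization.AtPrime Q) x ∈
      IsLocalRing.maximalIdeal (Localization.AtPrime Q) ^ 2 ↔ ∃ s, s ∉ Q ∧ s * x ∈ Q ^ 2 := by
  rw [← Localization.AtPrime.map_eq_maximalIdeal, ← Ideal.map_pow,
    IsLocalization.algebraMap_mem_map_algebraMap_iff Q.primeCompl]
  rfl

/-- The hypersurface `g = 0` in a regular domain is regular if and only if `g` does not vanish
to order two at any point. -/
theorem isRegularRing_quotient_span_singleton_iff {R : Type*} [CommRing R] [IsDomain R]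
    [IsRegularRing R] {g : R} (hg : g ≠ 0) :
    IsRegularRing (R ⧸ Ideal.span {g}) ↔
      ∀ Q : Ideal R, Q.IsPrime → g ∈ Q → ∀ s, s ∉ Q → s * g ∉ Q ^ 2 := by
  have key : ∀ (Q : Ideal R) [Q.IsPrime] (q : Ideal (R ⧸ Ideal.span {g})) [q.IsPrime],
      q.comap (Ideal.Quotient.mk _) = Q → g ∈ Q →
      (IsRegularLocalRing (Localization.AtPrime q) ↔ ∀ s, s ∉ Q → s * g ∉ Q ^ 2) := by
    intro Q _ q _ hq hgQ
    have hgm : algebraMap R (Localization.AtPrime Q) g ∈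
        IsLocalRing.maximalIdeal (Localization.AtPrime Q) :=
      (IsLocalization.AtPrime.to_map_mem_maximal_iff _ Q g).2 hgQ
    have hg0 : algebraMap R (Localization.AtPrime Q) g ≠ 0 := by
      simpa using hg
    have e := localizationQuotientEquiv (Ideal.span {g}) Q q hq
    rw [Ideal.map_span, Set.image_singleton] at e
    have h1 := isRegularLocalRing_quotient_span_singleton_iff hgm hg0
    rw [mem_maximalIdeal_sq_localization_iff] at h1
    push Not at h1
    rw [← h1]
    exact ⟨fun h => .of_ringEquiv e.symm, fun h => .of_ringEquiv e⟩
  rw [isRegularRing_iff]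
  constructor
  · intro h Q hQ hgQ
    have hle : Ideal.span {g} ≤ Q := (Ideal.span_singleton_le_iff_mem _).2 hgQ
    have hq : (Q.map (Ideal.Quotient.mk (Ideal.span {g}))).IsPrime :=
      Ideal.isPrime_map_quotientMk_of_isPrime hle
    refine (key Q (Q.map (Ideal.Quotient.mk _)) ?_ hgQ).1 (h _)
    rw [Ideal.comap_map_of_surjective _ Ideal.Quotient.mk_surjective,
      ← RingHom.ker_eq_comap_bot, Ideal.mk_ker, sup_eq_left.2 hle]
  · intro h q hq
    have hgq : g ∈ q.comap (Ideal.Quotient.mk (Ideal.span {g})) := by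
      rw [Ideal.mem_comap, Ideal.Quotient.eq_zero_iff_mem.2 (Ideal.mem_span_singleton_self g)]
      exact zero_mem q
    exact (key _ q rfl hgq).2 (h _ inferInstance hgq)

/-! ### Uniformizers at a prime of a Dedekind domain -/

theorem Ideal.mem_sq_of_mul_mem_sq {B : Type*} [CommRing B] {P : Ideal B} [P.IsMaximal] {α x : B}
    (hα : α ∉ P) (hx : x ∈ P) (h : α * x ∈ P ^ 2) : x ∈ P ^ 2 := by
  obtain ⟨u, i, hi, hu⟩ := (inferInstance : P.IsMaximal).exists_inv hα
  have h1 : i * x ∈ P ^ 2 := by rw [pow_two]; exact Ideal.mul_mem_mul hi hx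
  have h2 : x = u * (α * x) + i * x := by linear_combination (-x) * hu
  rw [h2]
  exact add_mem (Ideal.mul_mem_left _ _ h) h1

/-- An element of `P ∖ P²` generates `P` locally at `P`. -/
theorem exists_notMem_mul_mem_span_singleton {B : Type*} [CommRing B] [IsDedekindDomain B]
    {P : Ideal B} {π : B} (hπ : π ∈ P) (hπ2 : π ∉ P ^ 2) :
    ∃ s, s ∉ P ∧ ∀ y ∈ P, ∃ z, s * y = π * z := by
  -- With `(π) = P J` and `J` not inside `P`, any `s ∈ J ∖ P` satisfies `s P ⊆ (π)`.
  obtain ⟨J, hJ⟩ := Ideal.dvd_iff_le.2 ((Ideal.span_singleton_le_iff_mem _).2 hπ)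
  have hJP : ¬ J ≤ P := fun h => hπ2 <| by
    rw [← Ideal.span_singleton_le_iff_mem, hJ, pow_two]
    exact Ideal.mul_mono_right h
  obtain ⟨s, hsJ, hsP⟩ := SetLike.not_le_iff_exists.1 hJP
  refine ⟨s, hsP, fun y hy => ?_⟩
  have : s * y ∈ Ideal.span {π} := by
    rw [hJ, mul_comm s]
    exact Ideal.mul_mem_mul hy hsJ
  obtain ⟨z, hz⟩ := Ideal.mem_span_singleton'.1 this
  exact ⟨z, by rw [← hz, mul_comm]⟩

open MvPolynomial in
/-- A local uniformizer of `B` at `P` does not vanish to order two at the points above `P` of an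
affine space over `B`. -/
theorem mul_C_notMem_sq {B σ : Type*} [CommRing B] [IsDedekindDomain B] [Finite σ]
    {Q : Ideal (MvPolynomial σ B)} [Q.IsPrime] [hP : (Q.comap C).IsMaximal] {x : B}
    (hx : x ∈ Q.comap C) (hx2 : x ∉ (Q.comap C) ^ 2) {s : MvPolynomial σ B} (hs : s ∉ Q) :
    s * C x ∉ Q ^ 2 := by
  set P := Q.comap (C : B →+* MvPolynomial σ B) with hPdef
  have hx0 : x ≠ 0 := by rintro rfl; exact hx2 (zero_mem _)
  set I := P.map (C : B →+* MvPolynomial σ B)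
  have hIQ : I ≤ Q := Ideal.map_comap_le
  have hq : (Q.map (Ideal.Quotient.mk I)).IsPrime := Ideal.isPrime_map_quotientMk_of_isPrime hIQ
  let : Field (B ⧸ P) := Ideal.Quotient.field P
  have hreg : IsRegularRing (MvPolynomial σ B ⧸ I) :=
    IsRegularRing.of_ringEquiv (quotientEquivQuotientMvPolynomial (σ := σ) P).toRingEquiv
  have e := localizationQuotientEquiv I Q (Q.map (Ideal.Quotient.mk I)) (by
    rw [Ideal.comap_map_of_surjective _ Ideal.Quotient.mk_surjective,
      ← RingHom.ker_eq_comap_bot, Ideal.mk_ker, sup_eq_left.2 hIQ])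
  -- Locally at `Q` the ideal `I` is generated by `x`, and the quotient by `I` is regular, being a
  -- polynomial ring over `B ⧸ P`; hence `x` has order one.
  have hI : I.map (algebraMap _ (Localization.AtPrime Q)) =
      Ideal.span {algebraMap (MvPolynomial σ B) (Localization.AtPrime Q) (C x)} := by
    apply le_antisymm
    · rw [Ideal.map_map, Ideal.map_le_iff_le_comap]
      intro y hy
      obtain ⟨t, ht, htP⟩ := exists_notMem_mul_mem_span_singleton hx hx2
      obtain ⟨z, hz⟩ := htP y hy
      have hu : IsUnit (algebraMap (MvPolynomial σ B) (Localization.AtPrime Q) (C t)) :=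
        IsLocalization.map_units (Localization.AtPrime Q) (⟨C t, ht⟩ : Q.primeCompl)
      rw [Ideal.mem_comap, ← Ideal.unit_mul_mem_iff_mem _ hu, RingHom.comp_apply, ← map_mul,
        ← map_mul, hz, map_mul, map_mul]
      exact Ideal.mul_mem_right _ _ (Ideal.mem_span_singleton_self _)
    · rw [Ideal.span_singleton_le_iff_mem]
      exact Ideal.mem_map_of_mem _ (Ideal.mem_map_of_mem _ hx)
  rw [hI] at e
  have hx0' : algebraMap (MvPolynomial σ B) (Localization.AtPrime Q) (C x) ≠ 0 := by
    simpa using hx0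
  have hq' : IsRegularLocalRing (Localization.AtPrime (Q.map (Ideal.Quotient.mk I))) :=
    hreg.isRegularLocalRing_localization _
  have h1 := (isRegularLocalRing_quotient_span_singleton_iff
    ((IsLocalization.AtPrime.to_map_mem_maximal_iff _ Q (C x)).2 hx) hx0').1
    (hq'.of_ringEquiv e.symm)
  rw [mem_maximalIdeal_sq_localization_iff] at h1
  push Not at h1
  exact h1 s hs

/-! ### Singular points lie above `Γ` -/

open MvPolynomial in
theorem conicPoly_ne_zero {B : Type*} [CommRing B] [Nontrivial B] (a b c : B) :
    conicPoly a b c ≠ 0 := by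
  intro h
  have := congrArg constantCoeff h
  simp [conicPoly] at this

open MvPolynomial in
theorem comap_C_mem_conicGamma {B : Type*} [CommRing B] {a b c : B}
    {Q : Ideal (MvPolynomial (Fin 2) B)} [Q.IsPrime] (hg : conicPoly a b c ∈ Q)
    {s : MvPolynomial (Fin 2) B} (hs : s ∉ Q) (hsg : s * conicPoly a b c ∈ Q ^ 2) :
    Q.comap C ∈ conicGamma a b c := by
  have hQ : Q.IsPrime := inferInstance
  have hone : (1 : MvPolynomial (Fin 2) B) ∉ Q := (Ideal.ne_top_iff_one Q).1 hQ.ne_top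
  have hder : ∀ i, pderiv i (conicPoly a b c) ∈ Q := by
    intro i
    -- By the product rule, a derivation maps `Q²` into `Q`.
    have h1 : ∀ f ∈ Q ^ 2, pderiv i f ∈ Q := by
      intro f hf
      rw [pow_two] at hf
      refine Submodule.mul_induction_on hf (fun u hu v hv => ?_) (fun u v hu hv => ?_)
      · rw [pderiv_mul]
        exact add_mem (Ideal.mul_mem_left _ _ hv) (Ideal.mul_mem_right _ _ hu)
      · rw [map_add]; exact add_mem hu hv
    have h2 := h1 _ hsg
    rw [pderiv_mul] at h2
    have h3 := (Ideal.add_mem_iff_right _ (Ideal.mul_mem_left _ (pderiv i s) hg)).1 h2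
    exact (hQ.mem_or_mem h3).resolve_left hs
  have hX : C 2 * C a * X 0 + C b * X 1 ∈ Q := by
    have := hder 0
    simp only [conicPoly, map_add, map_sub, pderiv_mul, pderiv_pow, pderiv_C, pderiv_X_self,
      pderiv_one, pderiv_X_of_ne (show (1 : Fin 2) ≠ 0 by decide)] at this
    convert! this using 1
    rw [map_ofNat]
    simp
    ring
  have hY : C b * X 0 + C 2 * C c * X 1 ∈ Q := by
    have := hder 1
    simp only [conicPoly, map_add, map_sub, pderiv_mul, pderiv_pow, pderiv_C, pderiv_X_self,
      pderiv_one, pderiv_X_of_ne (show (0 : Fin 2) ≠ 1 by decide)] at this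
    convert! this using 1
    rw [map_ofNat]
    simp
    ring
  have h2 : (C 2 : MvPolynomial (Fin 2) B) ∈ Q := by
    have : (C 2 : MvPolynomial (Fin 2) B) = X 0 * (C 2 * C a * X 0 + C b * X 1) +
        X 1 * (C b * X 0 + C 2 * C c * X 1) - C 2 * conicPoly a b c := by
      simp only [conicPoly, map_ofNat]; ring
    rw [this]
    exact sub_mem (add_mem (Ideal.mul_mem_left _ _ hX) (Ideal.mul_mem_left _ _ hY))
      (Ideal.mul_mem_left _ _ hg)
  -- If `b ∉ Q`, the partial derivatives put `X` and `Y` in `Q`, whence `g ≡ -1` modulo `Q`.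
  have hb : (C b : MvPolynomial (Fin 2) B) ∈ Q := by
    by_contra hb
    have h1 : X 1 ∈ Q := by
      refine (hQ.mem_or_mem ((Ideal.add_mem_iff_right _ ?_).1 hX)).resolve_left hb
      exact Ideal.mul_mem_right _ _ (Ideal.mul_mem_right _ _ h2)
    have h0 : X 0 ∈ Q := by
      refine (hQ.mem_or_mem ((Ideal.add_mem_iff_left _ ?_).1 hY)).resolve_left hb
      exact Ideal.mul_mem_right _ _ (Ideal.mul_mem_right _ _ h2)
    refine hone ?_
    have : (1 : MvPolynomial (Fin 2) B) =
        (C a * X 0 + C b * X 1) * X 0 + C c * X 1 * X 1 - conicPoly a b c := by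
      simp only [conicPoly]; ring
    rw [this]
    exact sub_mem (add_mem (Ideal.mul_mem_left _ _ h0) (Ideal.mul_mem_left _ _ h1)) hg
  refine ⟨inferInstance, ?_, fun hac => hone ?_⟩
  · rw [Ideal.span_le]
    rintro x (rfl | rfl)
    · exact h2
    · exact hb
  · have ha : C a ∈ Q := hac (Ideal.subset_span (by simp))
    have hc : C c ∈ Q := hac (Ideal.subset_span (by simp))
    have : (1 : MvPolynomial (Fin 2) B) =
        X 0 ^ 2 * C a + X 0 * X 1 * C b + X 1 ^ 2 * C c - conicPoly a b c := by
      simp only [conicPoly]; ring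
    rw [this]
    exact sub_mem (add_mem (add_mem (Ideal.mul_mem_left _ _ ha) (Ideal.mul_mem_left _ _ hb))
      (Ideal.mul_mem_left _ _ hc)) hg

/-! ### Sufficiency of (i) and (ii) -/

open MvPolynomial in
/-- Modulo `2` and the squares of `a - d²`, `b - 2de`, `c - e²`, the conic is a double line. -/
theorem conicPoly_eq_sq_add {B : Type*} [CommRing B] (a b c d e : B) :
    conicPoly a b c = (C d * X 0 + C e * X 1 - 1) ^ 2 +
      (C (a - d ^ 2) * X 0 ^ 2 + C (b - 2 * d * e) * (X 0 * X 1) + C (c - e ^ 2) * X 1 ^ 2) +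
      C 2 * (C d * X 0 + C e * X 1 - 1) := by
  simp only [conicPoly, map_sub, map_mul, map_pow, map_ofNat]
  ring

-- Removing the terms `h²`, `2h` and `(b - 2de)XY`, all in `Q²`, leaves `(a - d²)X² + (c - e²)Y²`.
-- On `h = 0` this is, modulo `Q²` and up to a square factor from `B`, an element of `P ∖ P²`.
open MvPolynomial in
theorem mul_conicPoly_notMem_sq {B : Type*} [CommRing B] [IsDedekindDomain B] {a b c d e : B}
    {Q : Ideal (MvPolynomial (Fin 2) B)} [hQ : Q.IsPrime] [hP : (Q.comap C).IsMaximal]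
    (h2 : 2 ∈ Q.comap C) (hd : a - d ^ 2 ∈ Q.comap C) (he : c - e ^ 2 ∈ Q.comap C)
    (hi : a ∉ Q.comap C → b - 2 * d * e ∈ (Q.comap C) ^ 2 ∧
      c * d ^ 2 - a * e ^ 2 ∈ (Q.comap C) ^ 2 ∧ a - d ^ 2 ∉ (Q.comap C) ^ 2)
    (hii : a ∈ Q.comap C → a ∈ (Q.comap C) ^ 2 ∧ b ∈ (Q.comap C) ^ 2 ∧
      c - e ^ 2 ∉ (Q.comap C) ^ 2)
    (hg : conicPoly a b c ∈ Q) {s : MvPolynomial (Fin 2) B} (hs : s ∉ Q) :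
    s * conicPoly a b c ∉ Q ^ 2 := by
  intro hsg
  set P := Q.comap (C : B →+* MvPolynomial (Fin 2) B) with hPdef
  have hCsq : ∀ x ∈ P ^ 2, (C x : MvPolynomial (Fin 2) B) ∈ Q ^ 2 := fun x hx =>
    Ideal.le_comap_pow C 2 hx
  have hmul : ∀ {u v : MvPolynomial (Fin 2) B}, u ∈ Q → v ∈ Q → u * v ∈ Q ^ 2 := by
    intro u v hu hv
    rw [pow_two]
    exact Ideal.mul_mem_mul hu hv
  have hmulP : ∀ {u v : B}, u ∈ P → v ∈ P → u * v ∈ P ^ 2 := by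
    intro u v hu hv
    rw [pow_two]
    exact Ideal.mul_mem_mul hu hv
  have hab : b - 2 * d * e ∈ P ^ 2 := by
    by_cases ha : a ∈ P
    · have hdP : d ∈ P := hP.isPrime.mem_of_pow_mem 2 (by simpa using sub_mem ha hd)
      exact sub_mem (hii ha).2.1 (Ideal.mul_mem_right _ _ (hmulP h2 hdP))
    · exact (hi ha).1
  set h : MvPolynomial (Fin 2) B := C d * X 0 + C e * X 1 - 1 with hh
  have hhQ : h ∈ Q := by
    apply hQ.mem_of_pow_mem 2
    have : h ^ 2 = conicPoly a b c - (X 0 ^ 2 * C (a - d ^ 2) +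
        X 0 * X 1 * C (b - 2 * d * e) + X 1 ^ 2 * C (c - e ^ 2)) - h * C 2 := by
      rw [conicPoly_eq_sq_add a b c d e]; ring
    rw [this]
    refine sub_mem (sub_mem hg (add_mem (add_mem ?_ ?_) ?_)) ?_
    · exact Ideal.mul_mem_left _ _ hd
    · exact Ideal.mul_mem_left _ _ (show b - 2 * d * e ∈ P from Ideal.pow_le_self two_ne_zero hab)
    · exact Ideal.mul_mem_left _ _ he
    · exact Ideal.mul_mem_left _ _ h2
  have hr : s * (C (a - d ^ 2) * X 0 ^ 2 + C (c - e ^ 2) * X 1 ^ 2) ∈ Q ^ 2 := by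
    have : s * (C (a - d ^ 2) * X 0 ^ 2 + C (c - e ^ 2) * X 1 ^ 2) = s * conicPoly a b c -
        (s * (h * h) + s * (X 0 * X 1) * C (b - 2 * d * e) + s * (C 2 * h)) := by
      rw [conicPoly_eq_sq_add a b c d e]; ring
    rw [this]
    exact sub_mem hsg (add_mem (add_mem (Ideal.mul_mem_left _ _ (hmul hhQ hhQ))
      (Ideal.mul_mem_left _ _ (hCsq _ hab))) (Ideal.mul_mem_left _ _ (hmul h2 hhQ)))
  by_cases ha : a ∈ P
  · obtain ⟨ha2, -, hc2⟩ := hii ha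
    have hdP : d ∈ P := hP.isPrime.mem_of_pow_mem 2 (by simpa using sub_mem ha hd)
    refine mul_C_notMem_sq he hc2 hs ?_
    have had : a - d ^ 2 ∈ P ^ 2 := sub_mem ha2 (Ideal.pow_mem_pow hdP 2)
    -- As `d ∈ P`, `1 - e²Y² = (1 + eY)(dX - h)` lies in `Q`.
    have : s * C (c - e ^ 2) =
        C e ^ 2 * (s * (C (a - d ^ 2) * X 0 ^ 2 + C (c - e ^ 2) * X 1 ^ 2))
        - s * C e ^ 2 * X 0 ^ 2 * C (a - d ^ 2)
        + s * (C (c - e ^ 2) * (X 0 * (C e * X 1 + 1) * C d - (C e * X 1 + 1) * h)) := by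
      rw [hh]; ring
    rw [this]
    refine add_mem (sub_mem (Ideal.mul_mem_left _ _ hr) (Ideal.mul_mem_left _ _ (hCsq _ had)))
      (Ideal.mul_mem_left _ _ (hmul he ?_))
    exact sub_mem (Ideal.mul_mem_left _ _ hdP) (Ideal.mul_mem_left _ _ hhQ)
  · obtain ⟨-, hcd, had⟩ := hi ha
    refine mul_C_notMem_sq hd had hs ?_
    have h3 : (c - e ^ 2) * d ^ 2 - (a - d ^ 2) * e ^ 2 ∈ P ^ 2 := by
      have : (c - e ^ 2) * d ^ 2 - (a - d ^ 2) * e ^ 2 = c * d ^ 2 - a * e ^ 2 := by ring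
      rwa [this]
    -- Replacing `(c - e²)d²` by `(a - d²)e²` leaves the factor `d²X² + e²Y² = (h + 1)² - 2deXY`,
    -- which is `1` modulo `Q`.
    have : s * C (a - d ^ 2) =
        C d ^ 2 * (s * (C (a - d ^ 2) * X 0 ^ 2 + C (c - e ^ 2) * X 1 ^ 2))
        - s * X 1 ^ 2 * C ((c - e ^ 2) * d ^ 2 - (a - d ^ 2) * e ^ 2)
        + s * (C (a - d ^ 2) * (C d * X 0 * C e * X 1 * C 2 - (h + 2) * h)) := by
      rw [hh]
      simp only [map_sub, map_mul, map_pow, map_ofNat]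
      ring
    rw [this]
    refine add_mem (sub_mem (Ideal.mul_mem_left _ _ hr) (Ideal.mul_mem_left _ _ (hCsq _ h3)))
      (Ideal.mul_mem_left _ _ (hmul hd ?_))
    exact sub_mem (Ideal.mul_mem_left _ _ h2) (Ideal.mul_mem_left _ _ hhQ)

/-! ### Necessity of (i) and (ii) -/

open MvPolynomial in
/-- If the conic is regular, `π⁻¹ (g - h²)` has no zeros on the line `h = 0` above `P`, where
`h = d X + e Y - 1`. -/
theorem isUnit_eval_line {B T : Type*} [CommRing B] [CommRing T] {a b c d e : B}
    {P : Ideal B} (f : B →+* T) (hf : ∀ x, IsUnit (f x) ↔ x ∉ P) (hf0 : ∀ x ∈ P, f x = 0)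
    (h2 : 2 ∈ P)
    (hreg : ∀ Q : Ideal (MvPolynomial (Fin 2) B), Q.IsPrime → conicPoly a b c ∈ Q →
      ∀ s, s ∉ Q → s * conicPoly a b c ∉ Q ^ 2)
    {s π α β γ : B} (hs : s ∉ P) (hπ : π ∈ P)
    (hα : s * (a - d ^ 2) = π * α) (hβ : s * (b - 2 * d * e) = π * β)
    (hγ : s * (c - e ^ 2) = π * γ) {u v : T} (huv : f d * u + f e * v = 1) :
    IsUnit (f α * u ^ 2 + f β * (u * v) + f γ * v ^ 2) := by
  by_contra hunit
  -- A maximal ideal containing the value pulls back to a prime `Q` containing `h`, `ρ` and `P`,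
  -- where `s g = s h² + π ρ + 2 s h` lies in `Q²`.
  obtain ⟨M, hM, hFM⟩ := exists_max_ideal_of_mem_nonunits hunit
  set φ : MvPolynomial (Fin 2) B →+* T := eval₂Hom f ![u, v] with hφ
  have hφC : ∀ x, φ (C x) = f x := fun x => by simp [hφ]
  have hφ0 : φ (X 0) = u := by simp [hφ]
  have hφ1 : φ (X 1) = v := by simp [hφ]
  set Q := M.comap φ with hQdef
  have hCQ : ∀ x ∈ P, C x ∈ Q := by
    intro x hx
    rw [hQdef, Ideal.mem_comap, hφC, hf0 x hx]
    exact zero_mem M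
  set h : MvPolynomial (Fin 2) B := C d * X 0 + C e * X 1 - 1 with hh
  have hhQ : h ∈ Q := by
    rw [hQdef, Ideal.mem_comap, hh]
    simp [hφC, hφ0, hφ1, huv]
  set ρ : MvPolynomial (Fin 2) B := C α * X 0 ^ 2 + C β * (X 0 * X 1) + C γ * X 1 ^ 2 with hρ
  have hρQ : ρ ∈ Q := by
    rw [hQdef, Ideal.mem_comap, hρ]
    simpa [hφC, hφ0, hφ1] using hFM
  have hQ : Q.IsPrime := Ideal.comap_isPrime φ M
  have hsQ : C s ∉ Q := by
    rw [hQdef, Ideal.mem_comap, hφC]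
    exact fun hsM => hM.ne_top (Ideal.eq_top_of_isUnit_mem _ hsM ((hf s).2 hs))
  have hsg : C s * conicPoly a b c = C s * (h * h) + C π * ρ + C s * (C 2 * h) := by
    have h1 := congrArg (C : B → MvPolynomial (Fin 2) B) hα
    have h2 := congrArg (C : B → MvPolynomial (Fin 2) B) hβ
    have h3 := congrArg (C : B → MvPolynomial (Fin 2) B) hγ
    rw [C_mul, C_mul] at h1 h2 h3
    rw [conicPoly_eq_sq_add a b c d e, hρ]
    linear_combination X 0 ^ 2 * h1 + X 0 * X 1 * h2 + X 1 ^ 2 * h3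
  have hmul : ∀ {u v : MvPolynomial (Fin 2) B}, u ∈ Q → v ∈ Q → u * v ∈ Q ^ 2 := by
    intro u v hu hv
    rw [pow_two]
    exact Ideal.mul_mem_mul hu hv
  have hsg2 : C s * conicPoly a b c ∈ Q ^ 2 := by
    rw [hsg]
    exact add_mem (add_mem (Ideal.mul_mem_left _ _ (hmul hhQ hhQ)) (hmul (hCQ _ hπ) hρQ))
      (Ideal.mul_mem_left _ _ (hmul (hCQ _ h2) hhQ))
  have hgQ : conicPoly a b c ∈ Q :=
    (hQ.mem_or_mem (Ideal.pow_le_self two_ne_zero hsg2)).resolve_left hsQ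
  exact hreg Q hQ hgQ _ hsQ hsg2

open Polynomial in
/-- A quadratic polynomial over a field is a unit only if it is a nonzero constant. -/
theorem quadratic_isUnit {k : Type*} [Field k] {p q r : k}
    (h : IsUnit (C p * X ^ 2 + C q * X + C r)) : p = 0 ∧ q = 0 ∧ r ≠ 0 := by
  obtain ⟨t, ht, htp⟩ := Polynomial.isUnit_iff.1 h
  have h0 := congrArg (coeff · 0) htp
  have h1 := congrArg (coeff · 1) htp
  have h2 := congrArg (coeff · 2) htp
  simp [coeff_X, coeff_C, coeff_X_pow] at h0 h1 h2
  exact ⟨h2.symm, h1.symm, h0 ▸ ht.ne_zero⟩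

/-- Along the line `h = 0` over `B ⧸ P`, `ρ` is a polynomial of degree at most two that must be a
unit; the conditions are read off its coefficients. -/
theorem forall_mem_sq_of_forall_mul_conicPoly_notMem_sq {B : Type*} [CommRing B] [IsDedekindDomain B] {a b c d e : B}
    {P : Ideal B} [hP : P.IsMaximal] (hP0 : P ≠ ⊥) (h2 : 2 ∈ P) (hb : b ∈ P)
    (hac : ¬ Ideal.span {a, c} ≤ P)
    (hd : a - d ^ 2 ∈ P) (he : c - e ^ 2 ∈ P)
    (hreg : ∀ Q : Ideal (MvPolynomial (Fin 2) B), Q.IsPrime → conicPoly a b c ∈ Q →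
      ∀ s, s ∉ Q → s * conicPoly a b c ∉ Q ^ 2) :
    (a ∉ P → b - 2 * d * e ∈ P ^ 2 ∧ c * d ^ 2 - a * e ^ 2 ∈ P ^ 2 ∧ a - d ^ 2 ∉ P ^ 2) ∧
      (a ∈ P → a ∈ P ^ 2 ∧ b ∈ P ^ 2 ∧ c - e ^ 2 ∉ P ^ 2) := by
  let : Field (B ⧸ P) := Ideal.Quotient.field P
  obtain ⟨π, hπ, hπ2⟩ : ∃ π ∈ P, π ∉ P ^ 2 :=
    SetLike.exists_of_lt (Ideal.pow_succ_lt_pow hP0 1 |>.trans_eq (pow_one P))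
  obtain ⟨s, hs, hsP⟩ := exists_notMem_mul_mem_span_singleton hπ hπ2
  have hbde : b - 2 * d * e ∈ P :=
    sub_mem hb (Ideal.mul_mem_right _ _ (Ideal.mul_mem_right _ _ h2))
  obtain ⟨α, hα⟩ := hsP _ hd
  obtain ⟨β, hβ⟩ := hsP _ hbde
  obtain ⟨γ, hγ⟩ := hsP _ he
  have hmk0 : ∀ x, Ideal.Quotient.mk P x = 0 ↔ x ∈ P := fun x => Ideal.Quotient.eq_zero_iff_mem
  set f : B →+* Polynomial (B ⧸ P) := Polynomial.C.comp (Ideal.Quotient.mk P) with hf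
  have hfu : ∀ x, IsUnit (f x) ↔ x ∉ P := fun x => by
    rw [hf, RingHom.comp_apply, Polynomial.isUnit_C, isUnit_iff_ne_zero, Ne, hmk0]
  have hf0 : ∀ x ∈ P, f x = 0 := fun x hx => by
    rw [hf, RingHom.comp_apply, (hmk0 x).2 hx, map_zero]
  have hunit := fun u v => isUnit_eval_line (u := u) (v := v) f hfu hf0 h2 hreg hs hπ hα hβ hγ
  -- Up to the local unit `s`, `y` is `x / π`.
  have hsq : ∀ {x y : B}, s * x = π * y → x ∈ P → (x ∈ P ^ 2 ↔ y ∈ P) := by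
    intro x y hxy hx
    constructor
    · intro hx2
      by_contra hy
      refine hπ2 (Ideal.mem_sq_of_mul_mem_sq hy hπ ?_)
      rw [mul_comm, ← hxy]
      exact Ideal.mul_mem_left _ _ hx2
    · intro hy
      refine Ideal.mem_sq_of_mul_mem_sq hs hx ?_
      rw [hxy, pow_two]
      exact Ideal.mul_mem_mul hπ hy
  have h20 : (2 : B ⧸ P) = 0 := by rw [← map_ofNat (Ideal.Quotient.mk P) 2, (hmk0 2).2 h2]
  constructor
  · intro ha
    have hdP : d ∉ P := fun hdP => ha (by
      have := add_mem hd (Ideal.mul_mem_left _ d hdP)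
      rwa [show a - d ^ 2 + d * d = a by ring] at this)
    have hd0 : Ideal.Quotient.mk P d ≠ 0 := fun h => hdP ((hmk0 d).1 h)
    set δ := (Ideal.Quotient.mk P d)⁻¹ with hδ
    have hδd : Ideal.Quotient.mk P d * δ = 1 := mul_inv_cancel₀ hd0
    -- Here `d` is invertible modulo `P`: the line is `X = d⁻¹(1 - eY)`, with parameter `Y`.
    have hU := hunit (Polynomial.C δ * (1 - f e * Polynomial.X)) Polynomial.X (by
      simp only [hf, RingHom.comp_apply]
      rw [← mul_assoc, ← map_mul, hδd]
      simp)
    set A := Ideal.Quotient.mk P α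
    set D := Ideal.Quotient.mk P d
    set E := Ideal.Quotient.mk P e
    set Bb := Ideal.Quotient.mk P β
    set G := Ideal.Quotient.mk P γ
    have hU' : IsUnit (Polynomial.C (A * δ ^ 2 * E ^ 2 - Bb * δ * E + G) * Polynomial.X ^ 2 +
        Polynomial.C (Bb * δ - 2 * (A * δ ^ 2 * E)) * Polynomial.X + Polynomial.C (A * δ ^ 2)) := by
      convert hU using 1
      simp only [hf, RingHom.comp_apply, map_add, map_sub, map_mul, map_pow, map_ofNat]
      ring
    obtain ⟨hq2, hq1, hq0⟩ := quadratic_isUnit hU'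
    have hδ0 : δ ≠ 0 := inv_ne_zero hd0
    have hB0 : Bb = 0 := by
      rw [h20, zero_mul, sub_zero] at hq1
      exact (mul_eq_zero.1 hq1).resolve_right hδ0
    have hA0 : A ≠ 0 := left_ne_zero_of_mul hq0
    -- The `Y²`-coefficient times `D²` gives `G D² + A E² = 0`; the sign is immaterial in
    -- characteristic two.
    have hG : G * D ^ 2 - A * E ^ 2 = 0 := by
      rw [hB0] at hq2
      linear_combination D ^ 2 * hq2 + (-A * E ^ 2 * (D * δ + 1)) * hδd -
        A * E ^ 2 * h20
    refine ⟨(hsq hβ hbde).2 ((hmk0 β).1 hB0), ?_, fun h => hA0 ((hmk0 α).2 ((hsq hα hd).1 h))⟩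
    have hrw : c * d ^ 2 - a * e ^ 2 = (c - e ^ 2) * d ^ 2 - (a - d ^ 2) * e ^ 2 := by ring
    rw [hrw]
    refine (hsq (y := γ * d ^ 2 - α * e ^ 2) ?_ ?_).2 ?_
    · linear_combination d ^ 2 * hγ - e ^ 2 * hα
    · exact sub_mem (Ideal.mul_mem_right _ _ he) (Ideal.mul_mem_right _ _ hd)
    · rw [← hmk0]
      simpa using hG
  · intro ha
    have hdP : d ∈ P := hP.isPrime.mem_of_pow_mem 2 (by simpa using sub_mem ha hd)
    have heP : e ∉ P := fun heP => hac (by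
      rw [Ideal.span_le]
      rintro x (rfl | rfl)
      · exact ha
      · have := add_mem he (Ideal.mul_mem_left _ e heP)
        rwa [show x - e ^ 2 + e * e = x by ring] at this)
    have he0 : Ideal.Quotient.mk P e ≠ 0 := fun h => heP ((hmk0 e).1 h)
    set ε := (Ideal.Quotient.mk P e)⁻¹ with hε
    have hε0 : ε ≠ 0 := inv_ne_zero he0
    -- Here `d` vanishes modulo `P`: the line is `Y = e⁻¹`, with parameter `X`.
    have hU := hunit Polynomial.X (Polynomial.C ε) (by
      rw [hf0 d hdP, zero_mul, zero_add, hf, RingHom.comp_apply, ← map_mul, hε,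
        mul_inv_cancel₀ he0, map_one])
    have hU' : IsUnit (Polynomial.C (Ideal.Quotient.mk P α) * Polynomial.X ^ 2 +
        Polynomial.C (Ideal.Quotient.mk P β * ε) * Polynomial.X +
        Polynomial.C (Ideal.Quotient.mk P γ * ε ^ 2)) := by
      convert hU using 1
      simp only [hf, RingHom.comp_apply, map_mul, map_pow]
      ring
    obtain ⟨hq2, hq1, hq0⟩ := quadratic_isUnit hU'
    have hd2 : d ^ 2 ∈ P ^ 2 := Ideal.pow_mem_pow hdP 2
    have had := (hsq hα hd).2 ((hmk0 α).1 hq2)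
    have hbd := (hsq hβ hbde).2 ((hmk0 β).1 ((mul_eq_zero.1 hq1).resolve_right hε0))
    have h2d : 2 * d * e ∈ P ^ 2 := by
      rw [pow_two]
      exact Ideal.mul_mem_right _ _ (Ideal.mul_mem_mul h2 hdP)
    refine ⟨by simpa using add_mem had hd2, by simpa using add_mem hbd h2d, fun h => ?_⟩
    exact left_ne_zero_of_mul hq0 ((hmk0 γ).2 ((hsq hγ he).1 h))

theorem corollary8 {K : Type*} [Field K] [NumberField K] (a b c : 𝓞 K)
    (d e : Ideal (𝓞 K) → 𝓞 K)
    (hd : ∀ P ∈ conicGamma a b c, Ideal.Quotient.mk P (d P) ^ 2 = Ideal.Quotient.mk P a)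
    (he : ∀ P ∈ conicGamma a b c, Ideal.Quotient.mk P (e P) ^ 2 = Ideal.Quotient.mk P c) :
    IsRegularRing (ConicRing a b c) ↔
      ∀ P ∈ conicGamma a b c,
        (a ∉ P → b - 2 * d P * e P ∈ P ^ 2 ∧ c * d P ^ 2 - a * e P ^ 2 ∈ P ^ 2 ∧
          a - d P ^ 2 ∉ P ^ 2) ∧
        (a ∈ P → a ∈ P ^ 2 ∧ b ∈ P ^ 2 ∧ c - e P ^ 2 ∉ P ^ 2) := by
  have hP2 : ∀ P ∈ conicGamma a b c, 2 ∈ P := fun P hP => hP.2.1 (Ideal.subset_span (by simp))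
  have hP0 : ∀ P ∈ conicGamma a b c, P ≠ ⊥ := by
    rintro P hP rfl
    exact two_ne_zero ((Ideal.mem_bot).1 (hP2 _ hP))
  have hd' : ∀ P ∈ conicGamma a b c, a - d P ^ 2 ∈ P := fun P hP => by
    rw [← Ideal.Quotient.mk_eq_mk_iff_sub_mem, map_pow, hd P hP]
  have he' : ∀ P ∈ conicGamma a b c, c - e P ^ 2 ∈ P := fun P hP => by
    rw [← Ideal.Quotient.mk_eq_mk_iff_sub_mem, map_pow, he P hP]
  rw [isRegularRing_quotient_span_singleton_iff (conicPoly_ne_zero a b c)]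
  constructor
  · intro hreg P hP
    have : P.IsMaximal := hP.1.isMaximal (hP0 P hP)
    exact forall_mem_sq_of_forall_mul_conicPoly_notMem_sq (hP0 P hP) (hP2 P hP)
      (hP.2.1 (Ideal.subset_span (by simp))) hP.2.2 (hd' P hP) (he' P hP) hreg
  · intro hcond Q hQ hgQ s hs hsg
    have hP := comap_C_mem_conicGamma hgQ hs hsg
    have : (Q.comap MvPolynomial.C).IsMaximal := hP.1.isMaximal (hP0 _ hP)
    exact mul_conicPoly_notMem_sq (hP2 _ hP) (hd' _ hP) (he' _ hP) (hcond _ hP).1 (hcond _ hP).2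
      hgQ hs hsg
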